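/- All spaces are over $\mathbb{C}$. An operator sequence space $X$ is a linear space $E$ together with a norm $\|\cdot\|_n$ on the space of columns $E^n$ for every $n\ge 1$, such that $\|\alpha x\|_m\le\|\alpha\|\,\|x\|_n$ for all $x\in E^n$ and all matrices $\alpha\in M_{m,n}(\mathbb{C})$ (with $\|\alpha\|$ the operator norm $\ell_2^n\to\ell_2^m$), and $\left\|\binom{x}{y}\right\|_{n+m}^2\le\|x\|_n^2+\|y\|_m^2$ for all $x\in E^n$, $y\in E^m$. A linear operator $\varphi:X\to Y$ is sequentially bounded if $\|\varphi\|_{sb}:=\sup_n\|\varphi^{n}\|<\infty$, where $\varphi^{n}(x)=(\varphi(x_i))_{i}$ maps $(X^n,\|\cdot\|_n)$ to $(Y^n,\|\cdot\|_n)$; let $SQNor$ be the category of operator sequence spaces and sequentially bounded operators. Its isomorphisms are called sequential topological isomorphisms. Let $Nor$ be the category of normed spaces and bounded linear operators. The sequential dual is $X^\triangle=\mathcal{SB}(X,\mathbb{C})$ with the norm $\|\cdot\|_{sb}$, where the $n$-th norm of $\mathbb{C}$ is that of $\ell_2^n$; the adjoint of $\varphi:X\to Y$ is $\varphi^\triangle:Y^\triangle\to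 X^\triangle$, $f\mapsto f\varphi$. A sequentially bounded operator $\tau:X\to Y$ is called admissible if $\tau^\triangle$ has a bounded homogeneous right inverse, i.e. there are a map $\rho:X^\triangle\to Y^\triangle$ (not necessarily additive) and a constant $C\geq 0$ with $\rho(cf)=c\rho(f)$, $\|\rho(f)\|_{sb}\le C\|f\|_{sb}$ and $\tau^\triangle(\rho(f))=f$ for all $f\in X^\triangle$, $c\in\mathbb{C}$. An operator sequence space $I$ is pseudotopologically injective if for every admissible $\tau:X\to Y$ and every sequentially bounded $\varphi:X\to I$ there is a sequentially bounded $\psi:Y\to I$ with $\psi\tau=\varphi$. For a normed space $F$, $\min(F)$ is the operator sequence space on $F$ with $\|x\|_n=\sup\{\|\sum_{i=1}^n\xi_ix_i\|:\xi\in\ell_2^n,\ \|\xi\|\le1\}$. **Theorem.** For every pseudotopologically injective operator sequence space $I$ there exist a set $\Lambda$ and a normed space $F$ such that $F$ is a retract of $\ell_\infty(\Lambda)$ in $Nor$ (there are bounded linear operators $s:F\to\ell_\infty(\Lambda)$ and $r:\ell_\infty(\Lambda)\to F$ with $rs=1_F$) and $I$ is sequentially topologically isomorphic to $\min(F)$.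 -/

import Mathlib

open CategoryTheory Opposite
open scoped ENNReal

universe u v w

/-! ### Operator sequence spaces -/

/-- The product `α x ∈ E^m` of a scalar matrix `α ∈ M_{m,n}` and a column `x ∈ E^n`. -/
def colMul {E : Type*} [AddCommGroup E] [Module ℂ E] {m n : ℕ}
    (α : Matrix (Fin m) (Fin n) ℂ) (x : Fin n → E) : Fin m → E :=
  fun i => ∑ j, α i j • x j

open scoped Matrix.Norms.L2Operator in
/-- An operator sequence space structure on a complex linear space `E`: a norm on every `E^n`,
subject to the two axioms. Here `‖α‖` is the norm of `α` as an operator `ℓ₂^n → ℓ₂^m`, and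
`Fin.append x y` is the column `x` followed by the column `y`.
The index `n = 0` is allowed: `E^0` is the zero space, so its norm is forced to be `0` and both
axioms hold trivially when an index is `0`. -/
structure OpSeqStructure (E : Type*) [AddCommGroup E] [Module ℂ E] where
  /-- the norm of the `n`-th amplification -/
  nrm : ∀ n : ℕ, Seminorm ℂ (Fin n → E)
  eq_zero : ∀ (n : ℕ) (x : Fin n → E), nrm n x = 0 → x = 0
  nrm_colMul_le : ∀ (m n : ℕ) (α : Matrix (Fin m) (Fin n) ℂ) (x : Fin n → E),
    nrm m (colMul α x) ≤ ‖α‖ * nrm n x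
  nrm_append_sq_le : ∀ (m n : ℕ) (x : Fin n → E) (y : Fin m → E),
    nrm (n + m) (Fin.append x y) ^ 2 ≤ nrm n x ^ 2 + nrm m y ^ 2

/-- An operator sequence space. -/
structure SQNor : Type (u + 1) where
  carrier : Type u
  [addCommGroup : AddCommGroup carrier]
  [module : Module ℂ carrier]
  str : OpSeqStructure carrier

namespace SQNor

instance : CoeSort SQNor.{u} (Type u) := ⟨SQNor.carrier⟩

attribute [instance] SQNor.addCommGroup SQNor.module

/-- The norm of `X^n`, the `n`-th amplification of `X`. -/
def nrm (X : SQNor.{u}) (n : ℕ) : Seminorm ℂ (Fin n → X) := X.str.nrm n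

end SQNor

/-! ### Sequentially bounded operators and the category `SQNor` -/

/-- The `n`-th amplification `φ^n : X^n → Y^n` of a linear operator `φ`. -/
def amplification {E F : Type*} [AddCommGroup E] [Module ℂ E] [AddCommGroup F] [Module ℂ F]
    (φ : E →ₗ[ℂ] F) (n : ℕ) (x : Fin n → E) : Fin n → F :=
  fun i => φ (x i)

/-- The operator norm of the `n`-th amplification of `φ : X → Y`. -/
noncomputable def ampNorm {X : SQNor.{u}} {Y : SQNor.{v}} (φ : X →ₗ[ℂ] Y) (n : ℕ) : ℝ :=
  sInf {C : ℝ | 0 ≤ C ∧ ∀ x : Fin n → X, Y.nrm n (amplification φ n x) ≤ C * X.nrm n x}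

/-- `‖φ‖_sb = sup_n ‖φ^n‖`. -/
noncomputable def sbNorm {X : SQNor.{u}} {Y : SQNor.{v}} (φ : X →ₗ[ℂ] Y) : ℝ :=
  ⨆ n : ℕ, ampNorm φ n

/-- `φ` is sequentially bounded: the amplifications of `φ` are bounded operators and their
operator norms are bounded uniformly in `n`, that is, they have a common bound `C`. -/
def IsSeqBounded {X : SQNor.{u}} {Y : SQNor.{v}} (φ : X →ₗ[ℂ] Y) : Prop :=
  ∃ C : ℝ, 0 ≤ C ∧ ∀ (n : ℕ) (x : Fin n → X),
    Y.nrm n (amplification φ n x) ≤ C * X.nrm n x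

/-- The set `SB(X, Y)` of sequentially bounded operators. -/
structure SBHom (X : SQNor.{u}) (Y : SQNor.{v}) : Type (max u v) where
  toLin : X →ₗ[ℂ] Y
  bounded : IsSeqBounded toLin

namespace SBHom

@[ext] theorem ext {X : SQNor.{u}} {Y : SQNor.{v}} {φ ψ : SBHom X Y} (h : φ.toLin = ψ.toLin) : φ = ψ := by
  cases φ; cases ψ; cases h; rfl

/-- The identity operator. -/
def id (X : SQNor.{u}) : SBHom X X where
  toLin := LinearMap.id
  bounded := ⟨1, zero_le_one, fun n x => (one_mul (X.nrm n x)).ge⟩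

/-- Composition `ψ ∘ φ`. -/
def comp {X : SQNor.{u}} {Y : SQNor.{v}} {Z : SQNor.{w}} (ψ : SBHom Y Z) (φ : SBHom X Y) : SBHom X Z where
  toLin := ψ.toLin ∘ₗ φ.toLin
  bounded := by
    obtain ⟨C, hC, h⟩ := φ.bounded
    obtain ⟨D, hD, k⟩ := ψ.bounded
    refine ⟨D * C, mul_nonneg hD hC, fun n x => ?_⟩
    calc Z.nrm n (amplification (ψ.toLin ∘ₗ φ.toLin) n x)
        ≤ D * Y.nrm n (amplification φ.toLin n x) := k n (amplification φ.toLin n x)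
      _ ≤ D * (C * X.nrm n x) := mul_le_mul_of_nonneg_left (h n x) hD
      _ = D * C * X.nrm n x := by ring

end SBHom

/-- The category of operator sequence spaces and sequentially bounded operators. Isomorphisms in
it are the sequential topological isomorphisms. -/
instance : Category SQNor.{u} where
  Hom X Y := SBHom X Y
  id X := SBHom.id X
  comp φ ψ := ψ.comp φ

/-! ### The categories `Nor` and `Nor₀` -/

/-- A complex normed space. -/
structure Nor : Type (u + 1) where
  carrier : Type u
  [normedAddCommGroup : NormedAddCommGroup carrier]
  [normedSpace : NormedSpace ℂ carrier]

namespace Nor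

instance : CoeSort Nor.{u} (Type u) := ⟨Nor.carrier⟩

attribute [instance] Nor.normedAddCommGroup Nor.normedSpace

/-- The category of complex normed spaces and bounded linear operators. -/
instance : Category Nor.{u} where
  Hom E F := E →L[ℂ] F
  id E := ContinuousLinearMap.id ℂ E
  comp φ ψ := ψ.comp φ

/-- The space `ℓ_∞(Λ)` of bounded complex functions on `Λ` with the supremum norm. -/
noncomputable def linfty (Λ : Type u) : Nor.{u} where
  carrier := lp (fun _ : Λ => ℂ) ∞

end Nor

/-- A semilinear normed space over `ℂ`: scalars act on a set with a zero vector, there is no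
addition, and the norm is positive definite and absolutely homogeneous. -/
structure Nor₀ : Type (u + 1) where
  carrier : Type u
  [zero : Zero carrier]
  [action : MulActionWithZero ℂ carrier]
  nrm : carrier → ℝ
  nrm_nonneg : ∀ x, 0 ≤ nrm x
  eq_zero : ∀ x, nrm x = 0 → x = 0
  nrm_smul : ∀ (c : ℂ) (x : carrier), nrm (c • x) = ‖c‖ * nrm x

namespace Nor₀

instance : CoeSort Nor₀.{u} (Type u) := ⟨Nor₀.carrier⟩

attribute [instance] Nor₀.zero Nor₀.action

/-- A bounded semilinear operator (`φ (c x) = c φ(x)`, no additivity). -/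
structure BddHom (E F : Nor₀.{u}) : Type u where
  toFun : E → F
  map_smul : ∀ (c : ℂ) (x : E), toFun (c • x) = c • toFun x
  bounded : ∃ C : ℝ, 0 ≤ C ∧ ∀ x, F.nrm (toFun x) ≤ C * E.nrm x

@[ext] theorem BddHom.ext {E F : Nor₀.{u}} {φ ψ : BddHom E F} (h : φ.toFun = ψ.toFun) :
    φ = ψ := by
  cases φ; cases ψ; cases h; rfl

/-- The category of semilinear normed spaces and bounded semilinear operators. -/
instance : Category Nor₀.{u} where
  Hom E F := BddHom E F
  id E := ⟨fun x => x, fun _ _ => rfl, 1, zero_le_one, fun x => by simp⟩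
  comp {E F G} φ ψ := ⟨fun x => ψ.toFun (φ.toFun x),
    fun c x => by rw [φ.map_smul, ψ.map_smul], by
      obtain ⟨C, hC, h⟩ := φ.bounded
      obtain ⟨D, hD, k⟩ := ψ.bounded
      refine ⟨D * C, mul_nonneg hD hC, fun x => (k _).trans ?_⟩
      rw [mul_assoc]
      exact mul_le_mul_of_nonneg_left (h x) hD⟩

end Nor₀

/-! ### Minimal structures -/

/-- The identification of `E^n` with `B(ℓ₂^n, E)`: the column `x` acts as `ξ ↦ ∑ i, ξ_i x_i`. -/
noncomputable def colToOp (E : Type*) [NormedAddCommGroup E] [NormedSpace ℂ E] (n : ℕ) :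
    (Fin n → E) →ₗ[ℂ] (EuclideanSpace ℂ (Fin n) →L[ℂ] E) where
  toFun x := ∑ i, (EuclideanSpace.proj i : EuclideanSpace ℂ (Fin n) →L[ℂ] ℂ).smulRight (x i)
  map_add' x y := by ext ξ; simp [Finset.sum_add_distrib]
  map_smul' c x := by ext ξ; simp [Finset.smul_sum, smul_comm c]

theorem colToOp_apply {E : Type*} [NormedAddCommGroup E] [NormedSpace ℂ E] {n : ℕ}
    (x : Fin n → E) (ξ : EuclideanSpace ℂ (Fin n)) : colToOp E n x ξ = ∑ i, ξ i • x i := by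
  simp [colToOp]

open scoped Matrix.Norms.L2Operator in
theorem norm_transpose_mulVec_le {m n : ℕ} (α : Matrix (Fin m) (Fin n) ℂ)
    (ξ : EuclideanSpace ℂ (Fin m)) :
    ‖WithLp.toLp 2 (fun j => ∑ i, ξ i * α i j)‖ ≤ ‖α‖ * ‖ξ‖ := by
  have h := Matrix.l2_opNorm_mulVec (Matrix.conjTranspose α) (WithLp.toLp 2 (fun i => star (ξ i)))
  rw [Matrix.l2_opNorm_conjTranspose] at h
  have h1 : ‖(WithLp.toLp 2 (fun i => star (ξ i)) : EuclideanSpace ℂ (Fin m))‖ = ‖ξ‖ := by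
    simp [EuclideanSpace.norm_eq]
  rw [h1] at h
  refine le_trans (le_of_eq ?_) h
  rw [EuclideanSpace.norm_eq, EuclideanSpace.norm_eq]
  congr 1
  refine Finset.sum_congr rfl fun j _ => ?_
  congr 1
  rw [← norm_star]
  congr 1
  simp [Matrix.mulVec, dotProduct, mul_comm]

open scoped Matrix.Norms.L2Operator in
/-- The minimal operator sequence space structure on a normed space `E`:
`‖x‖_n = sup {‖∑ i, ξ_i x_i‖ : ξ ∈ ℓ₂^n, ‖ξ‖ ≤ 1}`, the norm of `x` in `B(ℓ₂^n, E)`. -/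
noncomputable def minStructure (E : Type*) [NormedAddCommGroup E] [NormedSpace ℂ E] :
    OpSeqStructure E where
  nrm n := (normSeminorm ℂ (EuclideanSpace ℂ (Fin n) →L[ℂ] E)).comp (colToOp E n)
  eq_zero n x h := by
    have h0 : colToOp E n x = 0 := by simpa using h
    funext i
    have := congrArg (fun T => T (EuclideanSpace.single i (1 : ℂ))) h0
    simpa [colToOp_apply, PiLp.single_apply] using this
  nrm_colMul_le m n α x := by
    simp only [Seminorm.comp_apply, coe_normSeminorm]
    refine ContinuousLinearMap.opNorm_le_bound _ (mul_nonneg (norm_nonneg _) (norm_nonneg _)) fun ξ => ?_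
    have e : colToOp E m (colMul α x) ξ
        = colToOp E n x (WithLp.toLp 2 (fun j => ∑ i, ξ i * α i j)) := by
      simp only [colToOp_apply, colMul, Finset.smul_sum, Finset.sum_smul, smul_smul]
      exact Finset.sum_comm
    rw [e]
    refine (ContinuousLinearMap.le_opNorm _ _).trans ?_
    refine (mul_le_mul_of_nonneg_left (norm_transpose_mulVec_le α ξ) (norm_nonneg _)).trans ?_
    exact le_of_eq (by ring)
  nrm_append_sq_le m n x y := by
    simp only [Seminorm.comp_apply, coe_normSeminorm]
    set a := ‖colToOp E n x‖
    set b := ‖colToOp E m y‖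
    have key : ‖colToOp E (n + m) (Fin.append x y)‖ ≤ √(a ^ 2 + b ^ 2) := by
      refine ContinuousLinearMap.opNorm_le_bound _ (by positivity) fun ξ => ?_
      set ξ₁ : EuclideanSpace ℂ (Fin n) := WithLp.toLp 2 (fun i => ξ (Fin.castAdd m i)) with hξ₁
      set ξ₂ : EuclideanSpace ℂ (Fin m) := WithLp.toLp 2 (fun i => ξ (Fin.natAdd n i)) with hξ₂
      have e : colToOp E (n + m) (Fin.append x y) ξ = colToOp E n x ξ₁ + colToOp E m y ξ₂ := by
        simp [colToOp_apply, Fin.sum_univ_add, hξ₁, hξ₂]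
      have hn : ‖ξ‖ ^ 2 = ‖ξ₁‖ ^ 2 + ‖ξ₂‖ ^ 2 := by
        simp [EuclideanSpace.norm_sq_eq, Fin.sum_univ_add, hξ₁, hξ₂]
      have h1 : ‖colToOp E n x ξ₁‖ ≤ a * ‖ξ₁‖ := ContinuousLinearMap.le_opNorm _ _
      have h2 : ‖colToOp E m y ξ₂‖ ≤ b * ‖ξ₂‖ := ContinuousLinearMap.le_opNorm _ _
      rw [e]
      refine (norm_add_le _ _).trans ((add_le_add h1 h2).trans ?_)
      refine abs_le_of_sq_le_sq' ?_ (by positivity) |>.2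
      rw [mul_pow, Real.sq_sqrt (by positivity), hn]
      nlinarith [sq_nonneg (a * ‖ξ₂‖ - b * ‖ξ₁‖)]
    calc _ ≤ √(a ^ 2 + b ^ 2) ^ 2 := pow_le_pow_left₀ (norm_nonneg _) key 2
      _ = a ^ 2 + b ^ 2 := Real.sq_sqrt (by positivity)

/-- The operator sequence space `min(E)`. -/
noncomputable def SQNor.min (E : Nor.{u}) : SQNor.{u} where
  carrier := E
  str := minStructure E

/-! ### The sequential dual -/

open scoped Matrix.Norms.L2Operator in
/-- The standard operator sequence space structure of `ℂ`, with `n`-th amplification `ℓ₂^n`. -/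
noncomputable def SQNor.scalars : SQNor.{0} where
  carrier := ℂ
  str :=
    { nrm := fun n => (normSeminorm ℂ (EuclideanSpace ℂ (Fin n))).comp
        (WithLp.linearEquiv 2 ℂ (Fin n → ℂ)).symm.toLinearMap
      eq_zero := fun n x h => by simpa using h
      nrm_colMul_le := fun m n α x => by
        have h := Matrix.l2_opNorm_mulVec α (WithLp.toLp 2 x)
        exact h
      nrm_append_sq_le := fun m n x y => by
        simp [EuclideanSpace.norm_sq_eq, Fin.sum_univ_add] }

section Dual

variable {X : SQNor.{u}} {Y : SQNor.{v}}

/-- The zero operator. -/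
instance : Zero (SBHom X Y) where
  zero :=
    { toLin := 0
      bounded := ⟨0, le_rfl, fun n x => by
        have e : amplification (0 : X →ₗ[ℂ] Y) n x = 0 := rfl
        rw [e]; simp⟩ }

/-- Scalar multiples of sequentially bounded operators. -/
instance : SMul ℂ (SBHom X Y) where
  smul c φ :=
    { toLin := c • φ.toLin
      bounded := by
        obtain ⟨C, hC, h⟩ := φ.bounded
        refine ⟨‖c‖ * C, by positivity, fun n x => ?_⟩
        have e : amplification (c • φ.toLin) n x = c • amplification φ.toLin n x := rfl
        rw [e, map_smul_eq_mul, mul_assoc]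
        exact mul_le_mul_of_nonneg_left (h n x) (norm_nonneg c) }

instance : MulActionWithZero ℂ (SBHom X Y) where
  one_smul φ := SBHom.ext (one_smul ℂ φ.toLin)
  mul_smul a b φ := SBHom.ext (mul_smul a b φ.toLin)
  smul_zero a := SBHom.ext (smul_zero (A := X →ₗ[ℂ] Y) a)
  zero_smul φ := SBHom.ext (zero_smul ℂ φ.toLin)

theorem ampNorm_nonneg (φ : X →ₗ[ℂ] Y) (n : ℕ) : 0 ≤ ampNorm φ n :=
  Real.sInf_nonneg fun _ h => h.1

theorem sbNorm_nonneg (φ : X →ₗ[ℂ] Y) : 0 ≤ sbNorm φ :=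
  Real.iSup_nonneg fun n => ampNorm_nonneg φ n

theorem sbNorm_le {φ : X →ₗ[ℂ] Y} {C : ℝ} (hC : 0 ≤ C)
    (h : ∀ (n : ℕ) (x : Fin n → X), Y.nrm n (amplification φ n x) ≤ C * X.nrm n x) :
    sbNorm φ ≤ C :=
  ciSup_le fun n => csInf_le ⟨0, fun _ h => h.1⟩ ⟨hC, h n⟩

theorem SBHom.le_sbNorm (φ : SBHom X Y) (n : ℕ) (x : Fin n → X) :
    Y.nrm n (amplification φ.toLin n x) ≤ sbNorm φ.toLin * X.nrm n x := by
  obtain ⟨C, hC, h⟩ := φ.bounded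
  have hb : BddAbove (Set.range (ampNorm φ.toLin)) :=
    ⟨C, by rintro _ ⟨n, rfl⟩; exact csInf_le ⟨0, fun _ h => h.1⟩ ⟨hC, h n⟩⟩
  have h1 : Y.nrm n (amplification φ.toLin n x) ≤ ampNorm φ.toLin n * X.nrm n x := by
    rcases (apply_nonneg (X.nrm n) x).eq_or_lt with h0 | h0
    · have := h n x
      rw [← h0] at this ⊢
      simpa using this
    · rw [← div_le_iff₀ h0]
      refine le_csInf ⟨C, hC, h n⟩ fun D hD => ?_
      rw [div_le_iff₀ h0]
      exact hD.2 x
  exact h1.trans (mul_le_mul_of_nonneg_right (le_ciSup hb n) (apply_nonneg _ _))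

theorem SBHom.eq_zero_of_sbNorm (φ : SBHom X Y) (h : sbNorm φ.toLin = 0) : φ = 0 := by
  apply SBHom.ext
  ext x
  have h1 := φ.le_sbNorm 1 (fun _ => x)
  rw [h, zero_mul] at h1
  have h2 := Y.str.eq_zero 1 _ (le_antisymm h1 (apply_nonneg _ _))
  exact congrFun h2 0

theorem SBHom.sbNorm_smul_le (c : ℂ) (φ : SBHom X Y) :
    sbNorm (c • φ).toLin ≤ ‖c‖ * sbNorm φ.toLin := by
  refine sbNorm_le (mul_nonneg (norm_nonneg c) (sbNorm_nonneg _)) fun n x => ?_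
  have e : amplification (c • φ).toLin n x = c • amplification φ.toLin n x := rfl
  rw [e, map_smul_eq_mul, mul_assoc]
  exact mul_le_mul_of_nonneg_left (φ.le_sbNorm n x) (norm_nonneg c)

theorem SBHom.sbNorm_smul (c : ℂ) (φ : SBHom X Y) :
    sbNorm (c • φ).toLin = ‖c‖ * sbNorm φ.toLin := by
  refine le_antisymm (SBHom.sbNorm_smul_le c φ) ?_
  rcases eq_or_ne c 0 with rfl | hc
  · simpa using sbNorm_nonneg _
  · have h := SBHom.sbNorm_smul_le c⁻¹ (c • φ)
    rw [inv_smul_smul₀ hc, norm_inv] at h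
    rwa [← le_inv_mul_iff₀ (norm_pos_iff.mpr hc)]

end Dual

/-- The underlying semilinear normed space of the first amplification of the sequential dual
`SB(X, ℂ)`: its norm is `‖·‖_sb`. -/
noncomputable def SQNor.dual (X : SQNor.{u}) : Nor₀.{u} where
  carrier := SBHom X SQNor.scalars
  nrm f := sbNorm f.toLin
  nrm_nonneg f := sbNorm_nonneg f.toLin
  eq_zero := SBHom.eq_zero_of_sbNorm
  nrm_smul := SBHom.sbNorm_smul

/-- The adjoint `f ↦ f ∘ φ` of a sequentially bounded operator, as a bounded semilinear
operator. -/
noncomputable def SQNor.adjoint {X Y : SQNor.{u}} (φ : X ⟶ Y) : Y.dual ⟶ X.dual :=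
  Nor₀.BddHom.mk (E := Y.dual) (F := X.dual) (fun f => SBHom.comp f φ) (fun _ _ => rfl)
    ⟨sbNorm (SBHom.toLin φ), sbNorm_nonneg _, fun f =>
      sbNorm_le (mul_nonneg (sbNorm_nonneg _) (sbNorm_nonneg _)) fun n x => by
        refine (SBHom.le_sbNorm f n (amplification (SBHom.toLin φ) n x)).trans ?_
        rw [mul_comm (sbNorm (SBHom.toLin φ)), mul_assoc]
        exact mul_le_mul_of_nonneg_left (SBHom.le_sbNorm φ n x) (sbNorm_nonneg _)⟩

/-- The functor `SQNor → Nor₀ᵒᵖ` sending an operator sequence space to its sequential dual,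
regarded as a semilinear normed space, and an operator to its adjoint. -/
noncomputable def dualFunctor : SQNor.{u} ⥤ Nor₀.{u}ᵒᵖ where
  obj X := op X.dual
  map φ := (SQNor.adjoint φ).op

/-! ### Injectivity with respect to a functor -/

section Rigged

universe v₁ v₂ u₁ u₂

variable {K : Type u₁} [Category.{v₁} K] {L : Type u₂} [Category.{v₂} L]

/-- `τ` is an admissible monomorphism with respect to the functor `S` if `S τ` is a coretraction,
that is, has a left inverse. -/
def IsAdmissibleMono (S : K ⥤ L) {X Y : K} (τ : X ⟶ Y) : Prop :=
  IsSplitMono (S.map τ)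

/-- `I` is injective with respect to the functor `S` if every morphism `X ⟶ I` extends along
every admissible monomorphism `X ⟶ Y`. -/
def IsInjectiveWrt (S : K ⥤ L) (I : K) : Prop :=
  ∀ ⦃X Y : K⦄ (τ : X ⟶ Y), IsAdmissibleMono S τ →
    Function.Surjective (fun g : Y ⟶ I => τ ≫ g)

end Rigged

/-- Pseudotopologically injective operator sequence spaces. -/
def IsPseudotopologicallyInjective (I : SQNor.{u}) : Prop :=
  IsInjectiveWrt dualFunctor.{u} I

/-! Admissibility only tests functionals, and functionals see very little of an operator sequence
space. On any `X` the level-one bound of a functional is at most its sequential norm, and on a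
minimal space a level-one bound is already a sequential bound (`scalars_nrm_amplification_le_min`).
Hence the identity `X → min(X₁)`, which is contractive, is admissible: a functional lifts to itself.
For injective `I`, extending the identity of `I` along it inverts it, so `I ≅ min(I₁)`.

Put `F = I₁` and let `F → ℓ_∞(Λ)` be evaluation on the dual ball `Λ`. A functional on `F` is a
scalar times a point of `Λ`, so it lifts to that scalar times a coordinate evaluation. Scalar and
point can be chosen homogeneously (`exists_homogeneous_polar`); additivity is lost, but
admissibility does not ask for it. So the embedding is admissible between minimal spaces, and
injectivity of `min(F) ≅ I` provides the retraction. -/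

/-! ### Functionals and operators on minimal spaces -/

theorem SQNor.scalars_nrm_one (c : Fin 1 → ℂ) : SQNor.scalars.nrm 1 c = ‖c 0‖ := by
  change ‖(WithLp.toLp 2 c : EuclideanSpace ℂ (Fin 1))‖ = ‖c 0‖
  simp [EuclideanSpace.norm_eq]

theorem SQNor.min_nrm (E : Nor.{u}) (n : ℕ) (x : Fin n → E) :
    (SQNor.min E).nrm n x = ‖colToOp E n x‖ := rfl

theorem SQNor.min_nrm_one (E : Nor.{u}) (x : E) :
    (SQNor.min E).nrm 1 (fun _ => x) = ‖x‖ := by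
  rw [SQNor.min_nrm]
  refine le_antisymm (ContinuousLinearMap.opNorm_le_bound _ (norm_nonneg _) fun ξ => ?_) ?_
  · rw [colToOp_apply]
    simp [EuclideanSpace.norm_eq, norm_smul, mul_comm]
  · have h := (colToOp E 1 fun _ => x).le_opNorm (EuclideanSpace.single 0 1)
    rw [colToOp_apply] at h
    simpa using h

/-- A bounded functional on `E` is sequentially bounded on `min(E)`, with the same bound. -/
theorem scalars_nrm_amplification_le_min (E : Nor.{u}) (f : E →ₗ[ℂ] ℂ) {C : ℝ} (hC : 0 ≤ C)
    (hf : ∀ x, ‖f x‖ ≤ C * ‖x‖) (n : ℕ) (x : Fin n → E) :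
    SQNor.scalars.nrm n (amplification f n x) ≤ C * (SQNor.min E).nrm n x := by
  rw [SQNor.min_nrm]
  set v : EuclideanSpace ℂ (Fin n) := WithLp.toLp 2 (fun i => f (x i)) with hv
  -- The conjugate of `v` is the extremal test vector: `f (∑ i, w i • x i) = ‖v‖ ^ 2` with `‖w‖ =
  -- ‖v‖`, and one factor `‖v‖` is cancelled at the end.
  set w : EuclideanSpace ℂ (Fin n) := WithLp.toLp 2 (fun i => star (f (x i))) with hw
  change ‖v‖ ≤ _
  have hvw : ‖w‖ = ‖v‖ := by simp [EuclideanSpace.norm_eq, hv, hw]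
  have h1 : ‖f (colToOp E n x w)‖ = ‖v‖ * ‖v‖ := by
    have e : f (colToOp E n x w) = ((‖v‖ ^ 2 : ℝ) : ℂ) := by
      rw [colToOp_apply, map_sum, EuclideanSpace.norm_sq_eq, Complex.ofReal_sum]
      refine Finset.sum_congr rfl fun i _ => ?_
      rw [map_smul, smul_eq_mul]
      simp [hv, hw, Complex.conj_mul']
    rw [e, Complex.norm_real, Real.norm_of_nonneg (by positivity), sq]
  have h2 : ‖v‖ * ‖v‖ ≤ C * ‖colToOp E n x‖ * ‖v‖ := by
    rw [← h1, mul_assoc, ← hvw]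
    exact (hf _).trans (mul_le_mul_of_nonneg_left (ContinuousLinearMap.le_opNorm _ _) hC)
  rcases (norm_nonneg v).eq_or_lt with h0 | h0
  · rw [← h0]; positivity
  · exact le_of_mul_le_mul_right h2 h0

theorem SBHom.norm_apply_le {X : SQNor.{u}} (f : SBHom X SQNor.scalars) (x : X) :
    norm (E := ℂ) (f.toLin x) ≤ sbNorm f.toLin * X.nrm 1 (fun _ => x) := by
  have h := f.le_sbNorm 1 (fun _ => x)
  exact (SQNor.scalars_nrm_one _).symm.le.trans h

/-- A bounded functional on `E`, as an element of the sequential dual of `min(E)`. -/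
noncomputable def SBHom.ofBoundedFunctional (E : Nor.{u}) (f : E →ₗ[ℂ] ℂ)
    (hf : ∃ C : ℝ, 0 ≤ C ∧ ∀ x, ‖f x‖ ≤ C * ‖x‖) : SBHom (SQNor.min E) SQNor.scalars where
  toLin := f
  bounded := hf.imp fun _ h => ⟨h.1, scalars_nrm_amplification_le_min E f h.1 h.2⟩

/-- A bounded operator `E → F`, as a sequentially bounded operator `min(E) → min(F)`. -/
noncomputable def SQNor.minMap {E F : Nor.{u}} (T : E →L[ℂ] F) : SQNor.min E ⟶ SQNor.min F where
  toLin := T.toLinearMap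
  bounded := ⟨‖T‖, norm_nonneg _, fun n (x : Fin n → E) => by
    have e : colToOp F n (amplification T.toLinearMap n x) = T.comp (colToOp E n x) := by
      ext ξ
      simp [colToOp_apply, amplification]
    change ‖colToOp F n (amplification T.toLinearMap n x)‖ ≤ ‖T‖ * ‖colToOp E n x‖
    rw [e]
    exact ContinuousLinearMap.opNorm_comp_le _ _⟩

/-- The bounded operator underlying a sequentially bounded operator `min(E) → min(F)`. -/
noncomputable def SBHom.toCLM {E F : Nor.{u}} (φ : SBHom (SQNor.min E) (SQNor.min F)) : E →L[ℂ] F :=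
  LinearMap.mkContinuous (show E →ₗ[ℂ] F from φ.toLin) (sbNorm φ.toLin) fun x => by
    have h := φ.le_sbNorm 1 (fun _ => x)
    rw [SQNor.min_nrm_one] at h
    exact (SQNor.min_nrm_one F _).symm.le.trans h

/-- The functional in the Banach dual of `E` underlying an element of the sequential dual of
`min(E)`. -/
noncomputable def SBHom.toDual {E : Nor.{u}} (f : SBHom (SQNor.min E) SQNor.scalars) : E →L[ℂ] ℂ :=
  LinearMap.mkContinuous (show E →ₗ[ℂ] ℂ from f.toLin) (sbNorm f.toLin) fun x => by
    have h := f.norm_apply_le x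
    rwa [SQNor.min_nrm_one] at h

theorem SBHom.norm_toDual_le {E : Nor.{u}} (f : SBHom (SQNor.min E) SQNor.scalars) :
    ‖f.toDual‖ ≤ sbNorm f.toLin :=
  LinearMap.mkContinuous_norm_le _ (sbNorm_nonneg _) _

/-- The dual functor is contravariant, so a section of the adjoint becomes, in the opposite
category, a left inverse of the image of `τ`. Contractive sections suffice for both uses. -/
theorem isAdmissibleMono_of_rightInverse {X Y : SQNor.{u}} (τ : X ⟶ Y)
    (ρ : SBHom X SQNor.scalars → SBHom Y SQNor.scalars)
    (hsmul : ∀ (c : ℂ) f, ρ (c • f) = c • ρ f)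
    (hbound : ∀ f, sbNorm (ρ f).toLin ≤ sbNorm f.toLin)
    (hright : ∀ f x, (ρ f).toLin (SBHom.toLin τ x) = f.toLin x) :
    IsAdmissibleMono dualFunctor τ := by
  let ρ' : X.dual ⟶ Y.dual := Nor₀.BddHom.mk (E := X.dual) (F := Y.dual) ρ hsmul
    ⟨1, zero_le_one, fun f => by rw [one_mul]; exact hbound f⟩
  refine ⟨⟨⟨ρ'.op, Quiver.Hom.unop_inj ?_⟩⟩⟩
  refine Nor₀.BddHom.ext (funext fun f => SBHom.ext (LinearMap.ext fun x => ?_))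
  exact hright f x

/-! ### The first amplification -/

/-- The normed space `(E, ‖·‖₁)` underlying an operator sequence space. -/
noncomputable def SQNor.firstLevel (X : SQNor.{u}) : Nor.{u} :=
  letI : Norm X := ⟨fun x => X.nrm 1 (fun _ => x)⟩
  have core : NormedSpace.Core ℂ X :=
    { norm_nonneg := fun x => apply_nonneg (X.nrm 1) _
      norm_smul := fun c x => map_smul_eq_mul (X.nrm 1) c (fun _ => x)
      norm_triangle := fun x y => map_add_le_add (X.nrm 1) (fun _ => x) (fun _ => y)
      norm_eq_zero_iff := fun x =>
        ⟨fun h => congrFun (X.str.eq_zero 1 _ h) 0, fun h => by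
          subst h; exact map_zero (X.nrm 1)⟩ }
  letI := NormedAddCommGroup.ofCore core
  letI := NormedSpace.ofCore core
  { carrier := X }

-- The adjoint of the row is the column `c ↦ c • star ξ`, which multiplies norms by exactly `‖ξ‖`.
open scoped Matrix.Norms.L2Operator in
theorem norm_row_le {n : ℕ} (ξ : EuclideanSpace ℂ (Fin n)) :
    ‖(Matrix.of fun (_ : Fin 1) j => ξ j : Matrix (Fin 1) (Fin n) ℂ)‖ ≤ ‖ξ‖ := by
  rw [← Matrix.l2_opNorm_conjTranspose, Matrix.l2_opNorm_def]
  refine ContinuousLinearMap.opNorm_le_bound _ (norm_nonneg _) fun c => le_of_eq ?_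
  have h : ∀ j, (Matrix.conjTranspose (Matrix.of fun (_ : Fin 1) j => ξ j)).mulVec c j
      = star (ξ j) * c 0 := fun j => by simp [Matrix.mulVec, dotProduct]
  have h2 : ‖ξ‖ * ‖c‖ = ‖c 0 • ξ‖ := by
    rw [norm_smul, mul_comm]; congr 1; simp [EuclideanSpace.norm_eq]
  rw [h2, EuclideanSpace.norm_eq, EuclideanSpace.norm_eq]
  congr 1
  refine Finset.sum_congr rfl fun j _ => ?_
  congr 1
  refine (congrArg norm (h j)).trans ?_
  simp [mul_comm]

/-- The vector `∑ j, ξ j • x j` is the product of the row matrix `ξ` with the column `x`, so the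
matrix axiom from level `n` to level `1` bounds it by `‖ξ‖` times the norm of `x`. -/
theorem SQNor.min_firstLevel_nrm_le (X : SQNor.{u}) (n : ℕ) (x : Fin n → X) :
    (SQNor.min X.firstLevel).nrm n x ≤ X.nrm n x := by
  refine ContinuousLinearMap.opNorm_le_bound _ (apply_nonneg _ _) fun ξ => ?_
  refine (congrArg norm (colToOp_apply (E := X.firstLevel) x ξ)).le.trans ?_
  rw [mul_comm]
  exact (X.str.nrm_colMul_le 1 n (Matrix.of fun _ j => ξ j) x).trans
    (mul_le_mul_of_nonneg_right (norm_row_le ξ) (apply_nonneg _ _))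

/-- The identity operator `X → min(X₁)`. -/
noncomputable def SQNor.toMin (X : SQNor.{u}) : X ⟶ SQNor.min X.firstLevel :=
  SBHom.mk (X := X) (Y := SQNor.min X.firstLevel) LinearMap.id ⟨1, zero_le_one, fun n x => by
    rw [one_mul]; exact X.min_firstLevel_nrm_le n x⟩

/-- Each functional lifts to itself: its level-one bound, at most its sequential norm, is all that
is needed on `min(X₁)`. -/
theorem SQNor.isAdmissibleMono_toMin (X : SQNor.{u}) : IsAdmissibleMono dualFunctor X.toMin :=
  isAdmissibleMono_of_rightInverse _
    (fun f => SBHom.ofBoundedFunctional X.firstLevel f.toLin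
      ⟨_, sbNorm_nonneg _, f.norm_apply_le⟩)
    (fun _ _ => rfl)
    (fun f => sbNorm_le (sbNorm_nonneg _)
      (scalars_nrm_amplification_le_min X.firstLevel f.toLin (sbNorm_nonneg _) f.norm_apply_le))
    (fun _ _ => rfl)

theorem nonempty_iso_min_firstLevel (I : SQNor.{u}) (hI : IsPseudotopologicallyInjective I) :
    Nonempty (I ≅ SQNor.min I.firstLevel) := by
  obtain ⟨g, hg⟩ := hI I.toMin I.isAdmissibleMono_toMin (𝟙 I)
  refine ⟨⟨I.toMin, g, hg, ?_⟩⟩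
  -- `I.toMin` is the identity on vectors, so `hg` already says that `g` fixes every vector; this
  -- gives the other composite too.
  refine SBHom.ext (LinearMap.ext fun x => ?_)
  exact congrArg (fun φ : I ⟶ I => SBHom.toLin φ x) hg

/-! ### Embedding into `ℓ_∞` -/

/-- Every vector is a scalar multiple of a vector of norm at most `1`, which depends only on the
line spanned by the vector. -/
theorem exists_homogeneous_polar (V : Type*) [NormedAddCommGroup V] [NormedSpace ℂ V] :
    ∃ (k : V → ℂ) (e : V → V), (∀ v, ‖e v‖ ≤ 1) ∧ (∀ v, ‖k v‖ ≤ ‖v‖) ∧ (∀ v, k v • e v = v) ∧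
      ∀ (c : ℂ) v, k (c • v) = c * k v ∧ (c ≠ 0 → e (c • v) = e v) := by
  classical
  have hr : ∀ v : V, ∃ a : ℂ, ∀ hv : v ≠ 0, a • (Projectivization.mk ℂ v hv).rep = v := fun v => by
    by_cases hv : v = 0
    · exact ⟨0, fun h => absurd hv h⟩
    · obtain ⟨a, ha⟩ := Projectivization.exists_smul_eq_mk_rep ℂ v hv
      exact ⟨(a⁻¹ : ℂˣ), fun _ => by rw [← ha, ← Units.smul_def, inv_smul_smul]⟩
  choose a ha using hr
  -- One nonzero vector is chosen on each line. Setting `R 0 = 0` makes the scalar `a v * ‖R v‖`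
  -- vanish at `v = 0`, where `a` is unconstrained.
  let R : V → V := fun v => if hv : v = 0 then 0 else (Projectivization.mk ℂ v hv).rep
  have hR0 : R 0 = 0 := by simp [R]
  have hRv : ∀ v, v ≠ 0 → R v ≠ 0 := fun v hv => by
    simpa [R, hv] using Projectivization.rep_nonzero _
  have haR : ∀ v, a v • R v = v := fun v => by
    by_cases hv : v = 0
    · simp [hv, hR0]
    · simpa [R, hv] using ha v hv
  have hRsmul : ∀ (c : ℂ) v, c ≠ 0 → R (c • v) = R v := fun c v hc => by
    by_cases hv : v = 0
    · simp [hv]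
    · have hcv : c • v ≠ 0 := smul_ne_zero hc hv
      have : Projectivization.mk ℂ (c • v) hcv = Projectivization.mk ℂ v hv :=
        (Projectivization.mk_eq_mk_iff' ℂ _ _ hcv hv).2 ⟨c, rfl⟩
      simp [R, hv, hc, this]
  -- Normalise the representative and move its length into the scalar, so that the scalar has
  -- modulus `‖v‖`.
  refine ⟨fun v => a v * ‖R v‖, fun v => (‖R v‖ : ℂ)⁻¹ • R v, fun v => ?_, fun v => ?_,
    fun v => ?_, fun c v => ⟨?_, fun hc => by simp only [hRsmul c v hc]⟩⟩
  · rw [norm_smul, norm_inv, Complex.norm_real, norm_norm]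
    exact inv_mul_le_one
  · rw [norm_mul, Complex.norm_real, norm_norm, ← norm_smul, haR]
  · by_cases hv : v = 0
    · simp [hv, hR0]
    · have : (‖R v‖ : ℂ) ≠ 0 := by simpa using hRv v hv
      dsimp only
      rw [smul_smul, mul_assoc, mul_inv_cancel₀ this, mul_one, haR]
  · by_cases hc : c = 0
    · simp [hc, hR0]
    by_cases hv : v = 0
    · simp [hv, hR0]
    have h : a (c • v) = c * a v := by
      -- Both scalars express `c • v` as a multiple of the same nonzero vector `R v`.
      refine smul_left_injective ℂ (hRv v hv) ?_
      dsimp only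
      rw [mul_smul, haR, ← hRsmul c v hc, haR]
    simp only [h, hRsmul c v hc, mul_assoc]

/-- The index set: the closed unit ball of the Banach dual. -/
abbrev Nor.DualBall (F : Nor.{u}) : Type u := {g : F →L[ℂ] ℂ // ‖g‖ ≤ 1}

/-- The operator `F → ℓ_∞` evaluating at the functionals of norm at most `1`. -/
noncomputable def Nor.toLinfty (F : Nor.{u}) : F →L[ℂ] Nor.linfty F.DualBall :=
  have hb : ∀ (x : F) (g : F.DualBall), ‖g.1 x‖ ≤ 1 * ‖x‖ := fun x g =>
    g.1.le_of_opNorm_le g.2 x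
  LinearMap.mkContinuous
    (F := lp (fun _ : F.DualBall => ℂ) ∞)
    { toFun := fun x => ⟨fun g => g.1 x, memℓp_infty ⟨1 * ‖x‖, by
        rintro _ ⟨g, rfl⟩; exact hb x g⟩⟩
      map_add' := fun x y => by ext g; exact map_add g.1 x y
      map_smul' := fun c x => by ext g; exact map_smul g.1 c x } 1
    fun x => lp.norm_le_of_forall_le (by positivity) (hb x)

/-- Evaluation of bounded functions at a point. -/
noncomputable def Nor.evalLinfty {Λ : Type u} (i : Λ) : Nor.linfty Λ →ₗ[ℂ] ℂ :=
  (lp.evalCLM ℂ (fun _ : Λ => ℂ) ∞ i).toLinearMap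

theorem Nor.norm_smul_evalLinfty_le {Λ : Type u} (c : ℂ) (i : Λ) (x : Nor.linfty Λ) :
    ‖(c • Nor.evalLinfty i) x‖ ≤ ‖c‖ * ‖x‖ := by
  rw [LinearMap.smul_apply, norm_smul]
  exact mul_le_mul_of_nonneg_left (lp.norm_apply_le_norm ENNReal.top_ne_zero _ i) (norm_nonneg c)

/-- Write a functional as `k • e` with `e` in the dual ball. On the image of `F`, the coordinate at
`e` is evaluation of `e`, so `k` times that coordinate extends the functional, with bound `‖k‖`. -/
theorem Nor.isAdmissibleMono_minMap_toLinfty (F : Nor.{u}) :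
    IsAdmissibleMono dualFunctor (SQNor.minMap F.toLinfty) := by
  obtain ⟨k, e, he, hk, hke, hc⟩ := exists_homogeneous_polar (F →L[ℂ] ℂ)
  refine isAdmissibleMono_of_rightInverse _
    (fun f => SBHom.ofBoundedFunctional (Nor.linfty F.DualBall)
      (k f.toDual • Nor.evalLinfty ⟨e f.toDual, he _⟩)
      ⟨_, norm_nonneg _, Nor.norm_smul_evalLinfty_le _ _⟩) ?_ ?_ ?_
  · intro c f
    have hd : (c • f).toDual = c • f.toDual := rfl
    refine SBHom.ext (LinearMap.ext fun x => ?_)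
    change k (c • f).toDual * Nor.evalLinfty ⟨e (c • f).toDual, he _⟩ x
      = c * (k f.toDual * Nor.evalLinfty ⟨e f.toDual, he _⟩ x)
    simp only [hd, (hc c _).1]
    -- For `c = 0` the chosen coordinate may change, but the factor `c` kills both sides.
    by_cases h0 : c = 0
    · simp [h0]
    · simp only [(hc c _).2 h0, mul_assoc]
  · intro f
    refine (sbNorm_le (norm_nonneg _) (scalars_nrm_amplification_le_min _ _ (norm_nonneg _)
      (Nor.norm_smul_evalLinfty_le _ _))).trans ((hk _).trans f.norm_toDual_le)
  · intro f x
    exact congrArg (fun g : F →L[ℂ] ℂ => g x) (hke f.toDual)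

/-! ### The retraction of `ℓ_∞` onto the first level -/

theorem mainTheorem9 (I : SQNor.{u}) (hI : IsPseudotopologicallyInjective I) :
    ∃ (Λ : Type u) (F : Nor.{u}),
      Nonempty (Retract F (Nor.linfty Λ)) ∧ Nonempty (I ≅ SQNor.min F) := by
  obtain ⟨α⟩ := nonempty_iso_min_firstLevel I hI
  refine ⟨I.firstLevel.DualBall, I.firstLevel, ?_, ⟨α⟩⟩
  -- Injectivity is known for `I` rather than for `min(F)`, so the map to extend is `α.inv : min(F)
  -- → I`; composing the extension with `α.hom` returns to `min(F)`.
  obtain ⟨ψ, hψ⟩ := hI _ I.firstLevel.isAdmissibleMono_minMap_toLinfty α.inv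
  have h : SQNor.minMap I.firstLevel.toLinfty ≫ ψ ≫ α.hom = 𝟙 _ := by
    rw [← Category.assoc]
    exact (congrArg (· ≫ α.hom) hψ).trans α.inv_hom_id
  refine ⟨⟨I.firstLevel.toLinfty, SBHom.toCLM (ψ ≫ α.hom), ContinuousLinearMap.ext fun x => ?_⟩⟩
  exact congrArg (fun φ : SQNor.min I.firstLevel ⟶ SQNor.min I.firstLevel => SBHom.toLin φ x) h
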